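/- Let $\mathbf k$ be a ring, and let $H_*(-)$ denote singular homology with coefficients in $\mathbf k$. For a closed smooth embedding $f : X \to Y$ of finite codimension $k$ of Hilbert manifolds, with oriented normal bundle $\pi : \nu \to X$, tubular neighbourhood $\exp : \nu \hookrightarrow Y$, closed tube $\mathrm{Tube} = \exp(D(\nu))$ with boundary $\partial\mathrm{Tube} = \exp(S(\nu))$ (where $D(\nu)$ and $S(\nu)$ are the unit disc and sphere bundles for a metric on $\nu$), and Thom class $\tau \in H^k(D(\nu), S(\nu); \mathbf k)$, the umkehr (shriek) map $f_! : H_{*}(Y) \to H_{*-k}(X)$ is the composite $$H_*(Y) \to H_*(Y, Y - f(X)) \cong H_*(\mathrm{Tube}, \partial \mathrm{Tube}) \xrightarrow{\ \exp^{-1}_*\ } H_*(D(\nu), S(\nu)) \xrightarrow{\ \pi_*(\tau \cap -)\ } H_{*-k}(X)$$ of the map induced by inclusion, the inverse of the excision isomorphism, the identification of the tube with the disc bundle, and the Thom isomorphism. Proposition. Let $h : X \to Y$ be a diffeomorphism between smooth connected Hilbert manifolds without boundary, regarded as a closed embedding of codimension $0$ whose (zero-dimensional) normal bundle has the canonical positive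 orientation. Then a tubular neighbourhood and a Thom class for $h$ exist, and for every choice of them the excision map $H_*(\mathrm{Tube}, \partial \mathrm{Tube}) \to H_*(Y, Y - h(X))$ is an isomorphism and $$h_! = (h_*)^{-1} : H_*(Y) \to H_*(X).$$ -/

import Mathlib

open CategoryTheory Limits AlgebraicTopology Simplicial Bundle Manifold ContDiff

universe u v w

/-!
Umkehr (shriek) maps in singular homology of closed embeddings of finite codimension between Hilbert
manifolds, through a tubular neighbourhood, excision and the Thom isomorphism.
-/

namespace Umkehr
section Cap
variable {C : Type u} [Category.{v} C] [HasCoproducts.{w} C] [Preadditive C] {S : SSet.{w}} {R : C}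

/-- The cap product of a `k`-cochain `φ` with simplicial chains: for `m = n + k`, an `m`-simplex `s`
is sent to `φ` (back `k`-face of `s`) times the front `n`-face of `s`. -/
noncomputable def cap {k : ℕ} (φ : (S.chainComplex R).X k ⟶ R) (m n : ℕ) (h : n + k = m) :
    (S.chainComplex R).X m ⟶ (S.chainComplex R).X n :=
  Cofan.IsColimit.desc (S.isColimitChainComplexXCofan R m) fun s : S _⦋m⦌ =>
    (S.ιChainComplex (S.map (SimplexCategory.subinterval n k h.le).op s) ≫ φ) ≫
      S.ιChainComplex (S.map (SimplexCategory.subinterval 0 n (by omega)).op s)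

lemma ι_cap {k : ℕ} (φ : (S.chainComplex R).X k ⟶ R) (m n : ℕ) (h : n + k = m) (s : S _⦋m⦌) :
    S.ιChainComplex s ≫ cap φ m n h =
      (S.ιChainComplex (S.map (SimplexCategory.subinterval n k h.le).op s) ≫ φ) ≫
        S.ιChainComplex (S.map (SimplexCategory.subinterval 0 n (by omega)).op s) :=
  Cofan.IsColimit.fac (S.isColimitChainComplexXCofan R m) _ s

lemma back_δ_low {m n k : ℕ} (h : n + k = m) (i : Fin (m + 2)) (hi : i.1 ≤ n) :
    SimplexCategory.subinterval n k h.le ≫ SimplexCategory.δ i =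
      SimplexCategory.subinterval (n + 1) k (by omega) := by
  ext (x : Fin (k + 1))
  change ((i.succAbove ⟨x.1 + n, by omega⟩ : Fin (m + 2)) : ℕ) = x.1 + (n + 1)
  simp only [Fin.succAbove, Fin.lt_def, Fin.val_castSucc]
  split_ifs <;> simp <;> omega

lemma front_δ_low {m n k : ℕ} (h : n + k = m) (i : Fin (m + 2)) (hi : i.1 ≤ n) :
    SimplexCategory.subinterval 0 n (by omega) ≫ SimplexCategory.δ i =
      SimplexCategory.δ (⟨i.1, by omega⟩ : Fin (n + 2)) ≫
        SimplexCategory.subinterval 0 (n + 1) (by omega) := by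
  ext (x : Fin (n + 1))
  change ((i.succAbove ⟨x.1 + 0, by omega⟩ : Fin (m + 2)) : ℕ) =
    ((⟨i.1, by omega⟩ : Fin (n + 2)).succAbove x).1 + 0
  simp only [Fin.succAbove, Fin.lt_def, Fin.val_castSucc]
  split_ifs <;> simp_all

lemma back_δ_high {m n k : ℕ} (h : n + k = m) (i : Fin (m + 2)) (j : Fin (k + 1))
    (hi : i.1 = n + 1 + j.1) :
    SimplexCategory.subinterval n k h.le ≫ SimplexCategory.δ i =
      SimplexCategory.δ j.succ ≫ SimplexCategory.subinterval n (k + 1) (by omega) := by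
  ext (x : Fin (k + 1))
  change ((i.succAbove ⟨x.1 + n, by omega⟩ : Fin (m + 2)) : ℕ) = (j.succ.succAbove x).1 + n
  simp only [Fin.succAbove, Fin.lt_def, Fin.val_castSucc, Fin.val_succ]
  split_ifs <;> simp <;> omega

lemma front_δ_high {m n k : ℕ} (h : n + k = m) (i : Fin (m + 2)) (hi : n + 1 ≤ i.1) :
    SimplexCategory.subinterval 0 n (by omega) ≫ SimplexCategory.δ i =
      SimplexCategory.subinterval 0 n (by omega) := by
  ext (x : Fin (n + 1))
  change ((i.succAbove ⟨x.1 + 0, by omega⟩ : Fin (m + 2)) : ℕ) = x.1 + 0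
  simp only [Fin.succAbove, Fin.lt_def, Fin.val_castSucc]
  split_ifs <;> simp; omega

lemma map_δ {a b c : ℕ} (f : ⦋a⦌ ⟶ ⦋b⦌) (i : Fin (b + 2)) (g : ⦋a⦌ ⟶ ⦋c⦌) (g' : ⦋c⦌ ⟶ ⦋b + 1⦌)
    (e : f ≫ SimplexCategory.δ i = g ≫ g') (s : S _⦋b + 1⦌) :
    S.map f.op (S.δ i s) = S.map g.op (S.map g'.op s) := by
  change (S.map (SimplexCategory.δ i).op ≫ S.map f.op) s = (S.map g'.op ≫ S.map g.op) s
  rw [← S.map_comp, ← S.map_comp, ← op_comp, ← op_comp, e]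

lemma map_δ' {a b : ℕ} (f : ⦋a⦌ ⟶ ⦋b⦌) (i : Fin (b + 2)) (g : ⦋a⦌ ⟶ ⦋b + 1⦌)
    (e : f ≫ SimplexCategory.δ i = g) (s : S _⦋b + 1⦌) :
    S.map f.op (S.δ i s) = S.map g.op s := by
  change (S.map (SimplexCategory.δ i).op ≫ S.map f.op) s = S.map g.op s
  rw [← S.map_comp, ← op_comp, e]

lemma back_δ_zero {m n k : ℕ} (h : n + k = m) :
    SimplexCategory.δ 0 ≫ SimplexCategory.subinterval n (k + 1) (by omega) =
      SimplexCategory.subinterval (n := m + 1) (n + 1) k (by omega) := by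
  ext (x : Fin (k + 1))
  change (((0 : Fin (k + 2)).succAbove x : Fin (k + 2)) : ℕ) + n = x.1 + (n + 1)
  simp only [Fin.zero_succAbove, Fin.val_succ]
  omega

lemma front_δ_last {m n k : ℕ} (h : n + k = m) :
    SimplexCategory.δ (Fin.last (n + 1)) ≫ SimplexCategory.subinterval 0 (n + 1) (by omega) =
      SimplexCategory.subinterval (n := m + 1) 0 n (by omega) := by
  ext (x : Fin (n + 1))
  change (((Fin.last (n + 1)).succAbove x : Fin (n + 2)) : ℕ) + 0 = x.1 + 0
  simp only [Fin.succAbove_last, Fin.val_castSucc]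

/-- The cap product with a cocycle is compatible with the differentials. -/
theorem cap_d {k : ℕ} (φ : (S.chainComplex R).X k ⟶ R)
    (hφ : (S.chainComplex R).d (k + 1) k ≫ φ = 0) (m n : ℕ) (h : n + k = m) :
    cap φ (m + 1) (n + 1) (by omega) ≫ (S.chainComplex R).d (n + 1) n =
      (S.chainComplex R).d (m + 1) m ≫ cap φ m n h := by
  apply SSet.chainComplex_hom_ext
  intro s
  have hc : S.ιChainComplex (S.map (SimplexCategory.subinterval (n + 1) k (by omega)).op s) ≫ φ =
      - ∑ j : Fin (k + 1), (-1 : ℤ) ^ (j.1 + 1) • (S.ιChainComplex (S.δ j.succ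
        (S.map (SimplexCategory.subinterval n (k + 1) (by omega)).op s)) ≫ φ) := by
    rw [eq_neg_iff_add_eq_zero]
    have := S.ιChainComplex (R := R)
      (S.map (SimplexCategory.subinterval n (k + 1) (by omega)).op s) ≫= hφ
    rw [SSet.ιChainComplex_d_assoc, comp_zero, Fin.sum_univ_succ, Preadditive.add_comp,
      Preadditive.sum_comp] at this
    simp only [Preadditive.zsmul_comp] at this
    rw [← this]
    congr 1
    simp only [Fin.val_zero, pow_zero, one_smul]
    congr 2
    change _ = (S.map (SimplexCategory.subinterval n (k + 1) (by omega)).op ≫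
      S.map (SimplexCategory.δ 0).op) s
    rw [← S.map_comp, ← op_comp, back_δ_zero h]
  rw [← Category.assoc, ι_cap, SSet.ιChainComplex_d_assoc, Category.assoc, SSet.ιChainComplex_d,
    Fin.sum_univ_castSucc, Preadditive.sum_comp]
  have hm : n + 1 + (k + 1) = m + 2 := by rw [← h]; ring
  have split (f : Fin (m + 2) → (R ⟶ (S.chainComplex R).X n)) :
      ∑ i, f i = ∑ i : Fin (n + 1), f (Fin.cast hm (Fin.castAdd (k + 1) i)) +
        ∑ j : Fin (k + 1), f (Fin.cast hm (Fin.natAdd (n + 1) j)) := by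
    rw [← Fin.sum_congr' f hm, Fin.sum_univ_add]
  rw [split]
  simp only [Preadditive.zsmul_comp, ι_cap, Preadditive.comp_add, Preadditive.comp_sum,
    Preadditive.comp_zsmul]
  congr 1
  · refine Finset.sum_congr rfl fun i _ => ?_
    rw [map_δ' _ _ _ (back_δ_low h (Fin.cast hm (Fin.castAdd (k + 1) i)) (by simp; omega)),
      map_δ _ _ _ _ (front_δ_low h (Fin.cast hm (Fin.castAdd (k + 1) i)) (by simp; omega))]
    rfl
  · rw [hc]
    simp only [Preadditive.neg_comp, Preadditive.sum_comp, Preadditive.zsmul_comp, smul_neg,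
      Finset.smul_sum, ← Finset.sum_neg_distrib]
    refine Finset.sum_congr rfl fun j _ => ?_
    rw [map_δ _ _ _ _ (back_δ_high h (Fin.cast hm (Fin.natAdd (n + 1) j)) j (by simp)),
      map_δ' _ _ _ (front_δ_high h (Fin.cast hm (Fin.natAdd (n + 1) j)) (by simp))]
    have e : S.map (SimplexCategory.subinterval 0 n (by omega)).op s =
        S.δ (Fin.last (n + 1)) (S.map (SimplexCategory.subinterval 0 (n + 1) (by omega)).op s) := by
      change _ = (S.map (SimplexCategory.subinterval 0 (n + 1) (by omega)).op ≫
        S.map (SimplexCategory.δ (Fin.last (n + 1))).op) s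
      rw [← S.map_comp, ← op_comp, front_δ_last h]
    rw [← e, smul_smul, ← neg_smul]
    congr 1
    simp
    ring
end Cap

section Relative

variable {C : Type u} [Category.{v} C] [HasCoproducts.{w} C] [Abelian C] (R : C)

/-- The singular chain complex of a space with coefficients in `R`. -/
noncomputable abbrev chains : TopCat.{w} ⥤ ChainComplex C ℕ :=
  (singularChainComplexFunctor C).obj R

/-- The `n`-th singular homology of a space with coefficients in `R`. -/
noncomputable abbrev singularHomology (n : ℕ) : TopCat.{w} ⥤ C :=
  (singularHomologyFunctor C n).obj R

/-- The relative singular chain complex: `C(X, A)` is the cokernel of `C(A) ⟶ C(X)`. -/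
noncomputable def relChains : TopPair.{w} ⥤ ChainComplex C ℕ :=
  MorphismProperty.Arrow.forget _ _ _ ⋙ (chains R).mapArrow ⋙ coker _

/-- The `n`-th relative singular homology of a pair with coefficients in `R`. -/
noncomputable def relHomology (n : ℕ) : TopPair.{w} ⥤ C :=
  relChains R ⋙ HomologicalComplex.homologyFunctor C _ n

/-- The projection `C(X) ⟶ C(X, A)`. -/
noncomputable def chainsToRel (P : TopPair.{w}) : (chains R).obj P.fst ⟶ (relChains R).obj P :=
  cokernel.π ((chains R).map P.map)

/-- The map `H_n(X) ⟶ H_n(X, A)` induced by the inclusion of `(X, ∅)` in `(X, A)`. -/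
noncomputable def homologyToRel (P : TopPair.{w}) (n : ℕ) :
    (singularHomology R n).obj P.fst ⟶ (relHomology R n).obj P :=
  HomologicalComplex.homologyMap (chainsToRel R P) n

variable {R}

lemma map_chainsToRel (P : TopPair.{w}) (m : ℕ) :
    ((chains R).map P.map).f m ≫ (chainsToRel R P).f m = 0 :=
  congrArg (fun f => HomologicalComplex.Hom.f f m) (cokernel.condition ((chains R).map P.map))

lemma chainsToRel_isColimit (P : TopPair.{w}) (m : ℕ) :
    Nonempty (IsColimit (CokernelCofork.ofπ (f := ((chains R).map P.map).f m)
      ((chainsToRel R P).f m) (map_chainsToRel P m))) :=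
  ⟨isColimitOfHasCokernelOfPreservesColimit (HomologicalComplex.eval C _ m)
    ((chains R).map P.map)⟩

lemma epi_chainsToRel (P : TopPair.{w}) (m : ℕ) : Epi ((chainsToRel R P).f m) :=
  epi_of_isColimit_cofork (chainsToRel_isColimit P m).some

/-- A morphism out of `C_m(X)` that vanishes on `C_m(A)` factors through `C_m(X, A)`. -/
noncomputable def relDesc (P : TopPair.{w}) (m : ℕ) {T : C} (φ : ((chains R).obj P.fst).X m ⟶ T)
    (hφ : ((chains R).map P.map).f m ≫ φ = 0) : ((relChains R).obj P).X m ⟶ T :=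
  (chainsToRel_isColimit P m).some.desc (CokernelCofork.ofπ φ hφ)

lemma chainsToRel_relDesc (P : TopPair.{w}) (m : ℕ) {T : C}
    (φ : ((chains R).obj P.fst).X m ⟶ T) (hφ : ((chains R).map P.map).f m ≫ φ = 0) :
    (chainsToRel R P).f m ≫ relDesc P m φ hφ = φ :=
  (chainsToRel_isColimit P m).some.fac (CokernelCofork.ofπ φ hφ) WalkingParallelPair.one

/-- The generator of `C_n(X)` given by a singular simplex. -/
noncomputable def ofSimplex (R : C) {X : TopCat.{w}} {n : ℕ} (s : TopCat.toSSet.obj X _⦋n⦌) :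
    R ⟶ ((chains R).obj X).X n :=
  (TopCat.toSSet.obj X).ιChainComplex s

lemma chains_hom_ext {X : TopCat.{w}} {n : ℕ} {T : C} {f g : ((chains R).obj X).X n ⟶ T}
    (h : ∀ s : TopCat.toSSet.obj X _⦋n⦌, ofSimplex R s ≫ f = ofSimplex R s ≫ g) : f = g :=
  SSet.chainComplex_hom_ext (X := TopCat.toSSet.obj X) h

lemma ofSimplex_map {X Y : TopCat.{w}} (f : X ⟶ Y) {n : ℕ} (s : TopCat.toSSet.obj X _⦋n⦌) :
    ofSimplex R s ≫ ((chains R).map f).f n = ofSimplex R ((TopCat.toSSet.map f).app _ s) :=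
  SSet.ι_chainComplexMap_f (X := TopCat.toSSet.obj X) (f := TopCat.toSSet.map f) (R := R) (x := s)

/-- The cap product of a singular `k`-cochain with singular chains. -/
noncomputable def topCap (X : TopCat.{w}) {k : ℕ} (φ : ((chains R).obj X).X k ⟶ R) (m n : ℕ)
    (h : n + k = m) : ((chains R).obj X).X m ⟶ ((chains R).obj X).X n :=
  cap (S := TopCat.toSSet.obj X) φ m n h

lemma ofSimplex_topCap {X : TopCat.{w}} {k : ℕ} (φ : ((chains R).obj X).X k ⟶ R) (m n : ℕ)
    (h : n + k = m) (s : TopCat.toSSet.obj X _⦋m⦌) :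
    ofSimplex R s ≫ topCap X φ m n h =
      (ofSimplex R ((TopCat.toSSet.obj X).map (SimplexCategory.subinterval n k h.le).op s) ≫ φ) ≫
        ofSimplex R ((TopCat.toSSet.obj X).map
          (SimplexCategory.subinterval 0 n (by omega)).op s) :=
  ι_cap (S := TopCat.toSSet.obj X) φ m n h s

lemma topCap_d {X : TopCat.{w}} {k : ℕ} (φ : ((chains R).obj X).X k ⟶ R)
    (hφ : ((chains R).obj X).d (k + 1) k ≫ φ = 0) (m n : ℕ) (h : n + k = m) :
    topCap X φ (m + 1) (n + 1) (by omega) ≫ ((chains R).obj X).d (n + 1) n =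
      ((chains R).obj X).d (m + 1) m ≫ topCap X φ m n h :=
  cap_d (S := TopCat.toSSet.obj X) φ hφ m n h

/-- The relative cap product `C_m(X, A) ⟶ C_n(X)`, `m = n + k`, with a relative cochain
`τ ∈ C^k(X, A; R) = Hom(C_k(X, A), R)`. -/
noncomputable def relCap (P : TopPair.{w}) {k : ℕ} (τ : ((relChains R).obj P).X k ⟶ R)
    (m n : ℕ) (h : n + k = m) : ((relChains R).obj P).X m ⟶ ((chains R).obj P.fst).X n :=
  relDesc P m (topCap P.fst ((chainsToRel R P).f k ≫ τ) m n h) (by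
    refine chains_hom_ext fun s => ?_
    rw [← Category.assoc, ofSimplex_map, ofSimplex_topCap, ← NatTrans.naturality_apply,
      ← ofSimplex_map]
    simp only [Category.assoc]
    rw [reassoc_of% map_chainsToRel (R := R) P k]
    simp)

lemma chainsToRel_relCap (P : TopPair.{w}) {k : ℕ} (τ : ((relChains R).obj P).X k ⟶ R)
    (m n : ℕ) (h : n + k = m) :
    (chainsToRel R P).f m ≫ relCap P τ m n h = topCap P.fst ((chainsToRel R P).f k ≫ τ) m n h :=
  chainsToRel_relDesc ..

lemma relCap_d (P : TopPair.{w}) {k : ℕ} (τ : ((relChains R).obj P).X k ⟶ R)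
    (hτ : ((relChains R).obj P).d (k + 1) k ≫ τ = 0) (m n : ℕ) (h : n + k = m) :
    relCap P τ (m + 1) (n + 1) (by omega) ≫ ((chains R).obj P.fst).d (n + 1) n =
      ((relChains R).obj P).d (m + 1) m ≫ relCap P τ m n h := by
  have := epi_chainsToRel (R := R) P (m + 1)
  rw [← cancel_epi ((chainsToRel R P).f (m + 1)), ← Category.assoc, chainsToRel_relCap,
    HomologicalComplex.Hom.comm_assoc, chainsToRel_relCap]
  refine topCap_d _ ?_ m n h
  rw [← HomologicalComplex.Hom.comm_assoc, hτ, comp_zero]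

lemma iCycles_relCap_d (P : TopPair.{w}) {k : ℕ} (τ : ((relChains R).obj P).X k ⟶ R)
    (hτ : ((relChains R).obj P).d (k + 1) k ≫ τ = 0) (m n : ℕ) (h : n + k = m) (j : ℕ) :
    (((relChains R).obj P).iCycles m ≫ relCap P τ m n h) ≫ ((chains R).obj P.fst).d n j = 0 := by
  by_cases hj : j + 1 = n
  · subst hj
    obtain ⟨m, rfl⟩ : ∃ m', m = m' + 1 := ⟨j + k, by omega⟩
    rw [Category.assoc, relCap_d P τ hτ m j (by omega), HomologicalComplex.iCycles_d_assoc, zero_comp]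
  · rw [HomologicalComplex.shape _ _ _ (by simpa using hj), comp_zero]

/-- The cap product `τ ∩ - : H_m(X, A) ⟶ H_n(X)`, `m = n + k`, with a relative `k`-cocycle `τ`. It is
the map on homology induced by `relCap P τ`. -/
noncomputable def homologyCap (P : TopPair.{w}) {k : ℕ} (τ : ((relChains R).obj P).X k ⟶ R)
    (hτ : ((relChains R).obj P).d (k + 1) k ≫ τ = 0) (m n : ℕ) (h : n + k = m) :
    (relHomology R m).obj P ⟶ (singularHomology R n).obj P.fst :=
  (((relChains R).obj P).homologyIsCokernel (m + 1) m (by simp)).desc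
    (CokernelCofork.ofπ
      (((chains R).obj P.fst).liftCycles (((relChains R).obj P).iCycles m ≫ relCap P τ m n h)
        _ rfl (iCycles_relCap_d P τ hτ m n h _) ≫ ((chains R).obj P.fst).homologyπ n)
      (by
        rw [← Category.assoc, HomologicalComplex.comp_liftCycles]
        refine HomologicalComplex.liftCycles_homologyπ_eq_zero_of_boundary _ _ _ _
          (relCap P τ (m + 1) (n + 1) (by omega)) ?_
        rw [relCap_d P τ hτ m n h, HomologicalComplex.toCycles_i_assoc]))

/-- The map of pairs `(X, A) ⟶ (Y, B)` given by a continuous map sending `A` into `B`. -/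
def pairMap {X Y : TopCat.{w}} (A : Set X) (B : Set Y) (f : X ⟶ Y) (h : Set.MapsTo f A B) :
    TopPair.ofSubset A ⟶ TopPair.ofSubset B :=
  TopPair.ofHom f (TopCat.ofHom ⟨h.restrict f A B, by fun_prop⟩)

universe x y

/-- A tubular neighbourhood of a closed embedding `f : X → Y` of codimension `k` of manifolds modelled
on (real) Hilbert spaces `E` and `E'`: a smooth vector bundle `ν = (V x)_x` of rank `k` over `X` with
a continuous inner product on the fibres, and a diffeomorphism `exp` of its total space onto an open
subset of `Y` which is `f` on the zero section. (The differential of `exp` along the zero section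
identifies `V x` with the normal space `T_{f x} Y / df (T_x X)`, so that `ν` is the normal bundle.) -/
structure TubularNeighborhood (E : Type x) [NormedAddCommGroup E] [InnerProductSpace ℝ E]
    (E' : Type y) [NormedAddCommGroup E'] [InnerProductSpace ℝ E']
    {X Y : Type w} [TopologicalSpace X] [ChartedSpace E X] [TopologicalSpace Y]
    [ChartedSpace E' Y] (f : X → Y) (k : ℕ) where
  /-- The embedding is closed. -/
  isClosed_range : IsClosed (Set.range f)
  /-- The model fibre of the normal bundle. -/
  F : Type w
  /-- The fibres of the normal bundle. -/
  V : X → Type w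
  [normedAddCommGroupF : NormedAddCommGroup F]
  [normedSpaceF : NormedSpace ℝ F]
  [finiteDimensional : FiniteDimensional ℝ F]
  finrank_eq : Module.finrank ℝ F = k
  [topologicalSpaceTotal : TopologicalSpace (TotalSpace F V)]
  [normedAddCommGroupV : ∀ x, NormedAddCommGroup (V x)]
  [innerProductSpaceV : ∀ x, InnerProductSpace ℝ (V x)]
  [fiberBundle : FiberBundle F V]
  [vectorBundle : VectorBundle ℝ F V]
  [contMDiffVectorBundle : ContMDiffVectorBundle ∞ F V 𝓘(ℝ, E)]
  [riemannian : IsContinuousRiemannianBundle F V]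
  /-- The identification of the total space with an open neighbourhood of `f(X)`. -/
  exp : TotalSpace F V → Y
  isLocalDiffeomorph_exp : IsLocalDiffeomorph (𝓘(ℝ, E).prod 𝓘(ℝ, F)) 𝓘(ℝ, E') ∞ exp
  injective_exp : Function.Injective exp
  exp_zero : ∀ x, exp ⟨x, 0⟩ = f x

namespace TubularNeighborhood

attribute [instance] normedAddCommGroupF normedSpaceF finiteDimensional topologicalSpaceTotal
  normedAddCommGroupV innerProductSpaceV fiberBundle vectorBundle contMDiffVectorBundle riemannian

variable {E : Type x} [NormedAddCommGroup E] [InnerProductSpace ℝ E]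
  {E' : Type y} [NormedAddCommGroup E'] [InnerProductSpace ℝ E']
  {X Y : Type w} [TopologicalSpace X] [ChartedSpace E X] [TopologicalSpace Y]
  [ChartedSpace E' Y] {f : X → Y} {k : ℕ} (T : TubularNeighborhood E E' f k)

lemma isOpenEmbedding_exp : Topology.IsOpenEmbedding T.exp :=
  .of_continuous_injective_isOpenMap T.isLocalDiffeomorph_exp.contMDiff.continuous
    T.injective_exp T.isLocalDiffeomorph_exp.isOpenMap

/-- The unit disc bundle `D(ν)`, as a subset of the total space. -/
def discSet : Set (TotalSpace T.F T.V) := {p | ‖p.2‖ ≤ 1}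

/-- The unit sphere bundle `S(ν) = ∂ν`, as a subset of the total space. -/
def sphereSet : Set (TotalSpace T.F T.V) := {p | ‖p.2‖ = 1}

/-- The unit disc bundle `D(ν)`, as a space. -/
abbrev Disc : TopCat.{w} := TopCat.of T.discSet

/-- The unit sphere bundle, as a subset of the disc bundle. -/
def sphere : Set T.Disc := {p | p.1 ∈ T.sphereSet}

/-- The closed tube `exp(D(ν))` around `f(X)`. -/
abbrev Tube : TopCat.{w} := TopCat.of (T.exp '' T.discSet)

/-- The boundary `exp(S(ν))` of the tube. -/
def tubeBoundary : Set T.Tube := {y | y.1 ∈ T.exp '' T.sphereSet}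

/-- The pair `(D(ν), S(ν))`. -/
abbrev discPair : TopPair.{w} := TopPair.ofSubset T.sphere

/-- The pair `(Tube, ∂Tube)`. -/
abbrev tubePair : TopPair.{w} := TopPair.ofSubset T.tubeBoundary

/-- The homeomorphism of pairs `(Tube, ∂Tube) ⟶ (D(ν), S(ν))` inverse to the restriction of
`exp`. -/
noncomputable def tubeToDisc : T.tubePair ⟶ T.discPair :=
  pairMap T.tubeBoundary T.sphere
    (TopCat.ofHom ((T.isOpenEmbedding_exp.isEmbedding.homeomorphImage T.discSet).symm : C(_, _)))
    (by
      intro y hy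
      obtain ⟨p, rfl⟩ :=
        (T.isOpenEmbedding_exp.isEmbedding.homeomorphImage T.discSet).surjective y
      obtain ⟨q, hq, hqp⟩ := hy
      obtain rfl : q = p.1 := T.injective_exp hqp
      change ((T.isOpenEmbedding_exp.isEmbedding.homeomorphImage T.discSet).symm
        (T.isOpenEmbedding_exp.isEmbedding.homeomorphImage T.discSet p)).1 ∈ T.sphereSet
      rwa [Homeomorph.symm_apply_apply])

/-- The pair `(Y, Y - f(X))`. -/
abbrev complementPair (f : X → Y) : TopPair.{w} :=
  TopPair.ofSubset (X := TopCat.of Y) (Set.range f)ᶜ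

/-- The inclusion of pairs `(Tube, ∂Tube) ⟶ (Y, Y - f(X))`. -/
def tubeInclusion : T.tubePair ⟶ complementPair f :=
  pairMap T.tubeBoundary (Set.range f)ᶜ (TopCat.ofHom ⟨Subtype.val, continuous_subtype_val⟩) (by
    rintro _ ⟨p, hp, h⟩ ⟨x, hx⟩
    have h0 : p = ⟨x, 0⟩ := T.injective_exp (by rw [T.exp_zero, hx, h]; rfl)
    subst h0
    simp [sphereSet] at hp)

/-- The projection `D(ν) ⟶ X` of the disc bundle. -/
def discProj : T.Disc ⟶ TopCat.of X :=
  TopCat.ofHom ⟨fun p => p.1.proj,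
    (FiberBundle.continuous_proj T.F T.V).comp continuous_subtype_val⟩

/-- A singular simplex of the fibre `V x` lying in the unit disc, as a singular simplex of
`D(ν)`. -/
noncomputable def fiberSimplex (x : X) {n : ℕ} (σ : C(stdSimplex ℝ (Fin (n + 1)), T.V x))
    (hσ : ∀ t, ‖σ t‖ ≤ 1) : TopCat.toSSet.obj T.Disc _⦋n⦌ :=
  (TopCat.toSSetObjEquiv T.Disc (.op ⦋n⦌)).symm
    ⟨fun t => ⟨⟨x, σ t⟩, hσ t⟩, ((FiberBundle.continuous_totalSpaceMk T.F T.V x).comp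
      σ.continuous).subtype_mk _⟩

section
variable {C : Type u} [Category.{v} C] [HasCoproducts.{w} C] [Abelian C]

open Classical in
/-- A relative singular cocycle representing the Thom class in `H^k(D(ν), S(ν); R)` of the normal
bundle with orientations `o x` of its fibres: its restriction to each fibre `(D(V x), S(V x))` is the
generator of `H^k` given by `o x`. That is, it has value `1` (resp. `-1`) on the fundamental cycle of
the fibre that a positively (resp. negatively) oriented basis `b` defines. Such a cycle is any singular
simplex `σ : (Δ^k, ∂Δ^k) → (D(V x), S(V x))` which is on `∂Δ^k` the radial projection of the affine
simplex with the vertices `-(b_1 + ⋯ + b_k), b_1, …, b_k`. -/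
structure ThomCocycle (o : ∀ x, Orientation ℝ (T.V x) (Fin k)) (R : C) where
  /-- The relative cochain. -/
  hom : ((relChains R).obj T.discPair).X k ⟶ R
  d_hom : ((relChains R).obj T.discPair).d (k + 1) k ≫ hom = 0
  normalized (x : X) (b : Module.Basis (Fin k) ℝ (T.V x))
    (σ : C(stdSimplex ℝ (Fin (k + 1)), T.V x)) (hσ : ∀ t, ‖σ t‖ ≤ 1)
    (_ : ∀ t, (∃ i, t i = 0) →
      ‖σ t‖ = 1 ∧ SameRay ℝ (σ t) (∑ i : Fin k, (t i.succ - t 0) • b i)) :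
    ofSimplex R (T.fiberSimplex x σ hσ) ≫ (chainsToRel R T.discPair).f k ≫ hom =
      if b.orientation = o x then 𝟙 R else -𝟙 R

variable (R : C)

/-- The map `H_n(Tube, ∂Tube) ⟶ H_n(Y, Y - f(X))` induced by the inclusion. -/
noncomputable def excision (n : ℕ) :
    (relHomology R n).obj T.tubePair ⟶ (relHomology R n).obj (complementPair f) :=
  (relHomology R n).map T.tubeInclusion

open Classical in
/-- The inverse of `T.excision R n` (which is an isomorphism by excision). -/
noncomputable def excisionInv (n : ℕ) :
    (relHomology R n).obj (complementPair f) ⟶ (relHomology R n).obj T.tubePair :=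
  if _ : IsIso (T.excision R n) then inv (T.excision R n) else 0

variable {R} in
/-- The umkehr map `f_! : H_m(Y) ⟶ H_n(X)`, `m = n + k`, that is the composite
`H_m(Y) ⟶ H_m(Y, Y - f(X)) ≅ H_m(Tube, ∂Tube) ≅ H_m(D(ν), S(ν)) ⟶ H_n(D(ν)) ⟶ H_n(X)`
of the map induced by the inclusion, the excision isomorphism, the identification of the tube with the
disc bundle, the cap product with the Thom class and the map induced by the projection. -/
noncomputable def umkehr {o : ∀ x, Orientation ℝ (T.V x) (Fin k)} (τ : T.ThomCocycle o R)
    (m n : ℕ) (h : n + k = m) :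
    (singularHomology R m).obj (TopCat.of Y) ⟶ (singularHomology R n).obj (TopCat.of X) :=
  homologyToRel R (complementPair f) m ≫ T.excisionInv R m ≫
    (relHomology R m).map T.tubeToDisc ≫ homologyCap T.discPair τ.hom τ.d_hom m n h ≫
      (singularHomology R n).map T.discProj

end
end TubularNeighborhood
end Relative
/-- The coefficients `K`, as a module over itself. -/
abbrev coeff (K : Type v) [Ring K] : ModuleCat.{max u v} K :=
  ModuleCat.of K (ULift.{u} K)

end Umkehr

namespace Umkehr

/-! In codimension `0` every normal fibre is a zero space. Hence `exp` is `h` composed with the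
bundle projection, the disc bundle is the whole total space, and the sphere bundle is empty. As `h`
is onto, the complement of its image is empty and the tube is all of the target, so the inclusion of
pairs is already an isomorphism and no excision theorem is needed (`isIso_tubeInclusion`).

The Thom cocycle has no freedom left: the only basis of a zero space is the empty one, which is
positively oriented, so the normalization forces the value `1` on each vertex
(`ThomCocycle.ofSimplex_hom`). Capping with such a `0`-cocycle fixes every chain, because the front
`n`-face of an `n`-simplex is the simplex itself (`topCap_zero_eq_id`).

Restricted to the homology of the tube, the umkehr map is therefore induced by the map from the tube
through the disc bundle to the source (`tubeInclusion_umkehr`). Following this map by `h` gives the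
inclusion of the tube, whose induced map can be cancelled; so the umkehr map is a one-sided inverse
of an isomorphism, hence its inverse. For existence, the trivial bundle of rank `0` and the unit
cochain suffice. -/

/-- A map on homology induced by a degreewise retraction is a retraction. -/
lemma homologyMap_comp_eq_id {C : Type u} [Category.{v} C] [Abelian C]
    {A B : ChainComplex C ℕ} (f : A ⟶ B) (n : ℕ) (c : B.X n ⟶ A.X n)
    (hc : f.f n ≫ c = 𝟙 _)
    (hd : (B.iCycles n ≫ c) ≫ A.d n ((ComplexShape.down ℕ).next n) = 0)
    {g : B.homology n ⟶ A.homology n}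
    (hg : B.homologyπ n ≫ g = A.liftCycles (B.iCycles n ≫ c) _ rfl hd ≫ A.homologyπ n) :
    HomologicalComplex.homologyMap f n ≫ g = 𝟙 _ := by
  have h : HomologicalComplex.cyclesMap f n ≫ A.liftCycles (B.iCycles n ≫ c) _ rfl hd = 𝟙 _ := by
    -- Cycles are compared inside the chains, where the degreewise retraction suffices; `c` need not
    -- extend to a chain map.
    rw [← cancel_mono (A.iCycles n)]
    simp [hc]
  rw [← cancel_epi (A.homologyπ n), HomologicalComplex.homologyπ_naturality_assoc, hg,
    reassoc_of% h, Category.comp_id]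

/-! ### Cap products with unit cocycles of degree zero -/

section Cap

variable {C : Type u} [Category.{v} C] [HasCoproducts.{w} C] [Abelian C] {R : C}

/-- The cap product with a `0`-cochain of value `1` on all vertices is the identity. -/
lemma topCap_zero_eq_id {X : TopCat.{w}} (φ : ((chains R).obj X).X 0 ⟶ R)
    (hφ : ∀ s : TopCat.toSSet.obj X _⦋0⦌, ofSimplex R s ≫ φ = 𝟙 R) (n : ℕ) :
    topCap X φ n n (add_zero n) = 𝟙 _ := by
  refine chains_hom_ext fun s => ?_
  have e : SimplexCategory.subinterval (n := n) 0 n (by omega) = 𝟙 _ := by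
    ext x
    rfl
  rw [ofSimplex_topCap, hφ, Category.id_comp, Category.comp_id, e, op_id]
  exact congrArg (ofSimplex R) ((TopCat.toSSet.obj X).map_id_apply _ s)

/-- The `0`-cochain of value `1` on all vertices. -/
noncomputable def unitCochain (R : C) (X : TopCat.{w}) : ((chains R).obj X).X 0 ⟶ R :=
  Cofan.IsColimit.desc ((TopCat.toSSet.obj X).isColimitChainComplexXCofan R 0) fun _ => 𝟙 R

lemma ofSimplex_unitCochain {X : TopCat.{w}} (s : TopCat.toSSet.obj X _⦋0⦌) :
    ofSimplex R s ≫ unitCochain R X = 𝟙 R :=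
  Cofan.IsColimit.fac ((TopCat.toSSet.obj X).isColimitChainComplexXCofan R 0) _ s

lemma d_unitCochain (X : TopCat.{w}) :
    ((chains R).obj X).d 1 0 ≫ unitCochain R X = 0 := by
  refine chains_hom_ext fun s => ?_
  have h := (TopCat.toSSet.obj X).ιChainComplex_d (R := R) s
  change ofSimplex R s ≫ ((chains R).obj X).d 1 0 =
    ∑ i : Fin 2, (-1) ^ i.val • ofSimplex R ((TopCat.toSSet.obj X).δ i s) at h
  rw [reassoc_of% h]
  -- The two endpoints of an edge contribute `1 - 1`.
  simp [Fin.sum_univ_two, Preadditive.add_comp, ofSimplex_unitCochain]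

/-- If the relative `0`-cocycle `τ` has value `1` on all vertices, then capping with `τ` is a
retraction of `H_n(X) ⟶ H_n(X, A)`. -/
lemma homologyToRel_homologyCap (P : TopPair.{w}) (τ : ((relChains R).obj P).X 0 ⟶ R)
    (hτ : ((relChains R).obj P).d (0 + 1) 0 ≫ τ = 0)
    (h1 : ∀ s : TopCat.toSSet.obj P.fst _⦋0⦌,
      ofSimplex R s ≫ (chainsToRel R P).f 0 ≫ τ = 𝟙 R) (n : ℕ) :
    homologyToRel R P n ≫ homologyCap P τ hτ n n (add_zero n) = 𝟙 _ := by
  have hc : (chainsToRel R P).f n ≫ relCap P τ n n (add_zero n) = 𝟙 _ := by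
    rw [chainsToRel_relCap, topCap_zero_eq_id _ h1]
  exact homologyMap_comp_eq_id (chainsToRel R P) n _ hc
    (iCycles_relCap_d P τ hτ n n (add_zero n) _)
    ((((relChains R).obj P).homologyIsCokernel (n + 1) n (by simp)).fac _
      WalkingParallelPair.one)

/-- The quotient map onto relative chains is a cokernel projection, and these are natural in the
morphism whose cokernel is taken. -/
lemma homologyToRel_naturality {P Q : TopPair.{w}} (f : P ⟶ Q) (n : ℕ) :
    (singularHomology R n).map (TopPair.Hom.fst f) ≫ homologyToRel R Q n =
      homologyToRel R P n ≫ (relHomology R n).map f := by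
  have h : (chains R).map (TopPair.Hom.fst f) ≫ chainsToRel R Q =
      chainsToRel R P ≫ (relChains R).map f :=
    ((coker.π (ChainComplex C ℕ)).naturality
      ((chains R).mapArrow.map ((MorphismProperty.Arrow.forget _ _ _).map f)))
  exact (HomologicalComplex.homologyMap_comp _ _ n).symm.trans
    ((congrArg (HomologicalComplex.homologyMap · n) h).trans
      (HomologicalComplex.homologyMap_comp _ _ n))

/-- Comparison of a cap product through a pair `P` with maps to `Q` and `D`. -/
lemma map_homologyToRel_homologyCap {P Q D : TopPair.{w}} (i : P ⟶ Q) (j : P ⟶ D)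
    (τ : ((relChains R).obj D).X 0 ⟶ R) (hτ : ((relChains R).obj D).d (0 + 1) 0 ≫ τ = 0)
    (h1 : ∀ s : TopCat.toSSet.obj D.fst _⦋0⦌,
      ofSimplex R s ≫ (chainsToRel R D).f 0 ≫ τ = 𝟙 R) (n : ℕ)
    (ι : (relHomology R n).obj Q ⟶ (relHomology R n).obj P)
    (hι : (relHomology R n).map i ≫ ι = 𝟙 _) {Z : TopCat.{w}} (p : D.fst ⟶ Z) :
    (singularHomology R n).map (TopPair.Hom.fst i) ≫ homologyToRel R Q n ≫ ι ≫
        (relHomology R n).map j ≫ homologyCap D τ hτ n n (add_zero n) ≫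
          (singularHomology R n).map p =
      (singularHomology R n).map (TopPair.Hom.fst j ≫ p) := by
  -- Naturality moves `i` past the passage to relative homology, where it cancels `ι`; naturality
  -- for `j` then places that passage next to the cap product, which undoes it.
  rw [← Category.assoc, homologyToRel_naturality, Category.assoc, reassoc_of% hι,
    ← Category.assoc, ← homologyToRel_naturality, Category.assoc,
    ← Category.assoc (homologyToRel R _ n), homologyToRel_homologyCap _ _ _ h1,
    Category.id_comp, Functor.map_comp]

end Cap

/-! ### Isomorphisms of pairs -/

section PairMap

/-- A homeomorphism of pairs is an isomorphism. -/
lemma isIso_pairMap {X Y : TopCat.{w}} (A : Set X) (B : Set Y) (f : X ≅ Y)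
    (h : Set.MapsTo f.hom A B) (h' : Set.MapsTo f.inv B A) : IsIso (pairMap A B f.hom h) := by
  refine ⟨pairMap B A f.inv h', ?_, ?_⟩
  · refine MorphismProperty.Arrow.Hom.ext ?_ ?_
    · ext x
      exact Subtype.ext (Iso.hom_inv_id_apply f x.1)
    · exact f.hom_inv_id
  · refine MorphismProperty.Arrow.Hom.ext ?_ ?_
    · ext x
      exact Subtype.ext (Iso.inv_hom_id_apply f x.1)
    · exact f.inv_hom_id

end PairMap

namespace TubularNeighborhood

universe x y

variable {E : Type x} [NormedAddCommGroup E] [InnerProductSpace ℝ E]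
  {E' : Type y} [NormedAddCommGroup E'] [InnerProductSpace ℝ E']
  {X Y : Type w} [TopologicalSpace X] [ChartedSpace E X] [TopologicalSpace Y]
  [ChartedSpace E' Y] {f : X → Y}

/-! ### Tubes, Thom cocycles and umkehr maps in codimension zero -/

section CodimZero

variable (T : TubularNeighborhood E E' f 0)

lemma subsingleton_fiber (x : X) : Subsingleton (T.V x) := by
  have : Subsingleton T.F := Module.finrank_zero_iff.1 T.finrank_eq
  exact ((trivializationAt T.F T.V x).continuousLinearEquivAt ℝ x
    (FiberBundle.mem_baseSet_trivializationAt T.F T.V x)).toEquiv.subsingleton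

lemma eq_zero_section (p : TotalSpace T.F T.V) : p = ⟨p.proj, 0⟩ := by
  have := T.subsingleton_fiber p.proj
  obtain ⟨x, v⟩ := p
  exact congrArg _ (Subsingleton.elim (α := T.V x) v 0)

lemma exp_eq (p : TotalSpace T.F T.V) : T.exp p = f p.proj := by
  rw [← T.exp_zero, ← T.eq_zero_section]

lemma mem_discSet (p : TotalSpace T.F T.V) : p ∈ T.discSet := by
  rw [T.eq_zero_section p]
  simp [discSet]

lemma sphereSet_eq_empty : T.sphereSet = ∅ := by
  refine Set.eq_empty_of_forall_notMem fun p hp => ?_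
  rw [T.eq_zero_section p] at hp
  simp [sphereSet] at hp

lemma tube_eq_univ (hf : Function.Surjective f) : T.exp '' T.discSet = Set.univ := by
  refine Set.eq_univ_of_forall fun y => ?_
  obtain ⟨x, rfl⟩ := hf y
  exact ⟨⟨x, 0⟩, T.mem_discSet _, T.exp_zero x⟩

/-- In codimension `0`, the tube around the image of a surjective map is the whole manifold. -/
def tubeIso (hf : Function.Surjective f) : T.Tube ≅ TopCat.of Y :=
  TopCat.isoOfHomeo
    ((Homeomorph.setCongr (T.tube_eq_univ hf)).trans (Homeomorph.Set.univ Y))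

lemma isIso_tubeInclusion (hf : Function.Surjective f) : IsIso T.tubeInclusion :=
  isIso_pairMap (Y := TopCat.of Y) T.tubeBoundary (Set.range f)ᶜ (T.tubeIso hf) _
    -- The inverse respects the subspaces vacuously, since the complement of the image is empty.
    (fun y hy => (hy (hf y)).elim)

/-- Holds because `tubeToDisc` inverts `exp`, and `exp` is `f` after the projection. -/
lemma tubeToDisc_discProj (y : T.Tube) :
    f (T.discProj (TopPair.Hom.fst T.tubeToDisc y)) = y.1 := by
  obtain ⟨p, rfl⟩ :=
    (T.isOpenEmbedding_exp.isEmbedding.homeomorphImage T.discSet).surjective y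
  change f ((T.isOpenEmbedding_exp.isEmbedding.homeomorphImage T.discSet).symm
    (T.isOpenEmbedding_exp.isEmbedding.homeomorphImage T.discSet p)).1.proj = T.exp p.1
  rw [Homeomorph.symm_apply_apply, T.exp_eq]

/-- In codimension `0`, all vertices of the disc bundle lie in fibres. -/
lemma exists_fiberSimplex_eq (s : TopCat.toSSet.obj T.Disc _⦋0⦌) :
    ∃ (x : X) (σ : C(stdSimplex ℝ (Fin (0 + 1)), T.V x)) (hσ : ∀ t, ‖σ t‖ ≤ 1),
      T.fiberSimplex x σ hσ = s := by
  let g := TopCat.toSSetObjEquiv T.Disc (.op ⦋0⦌) s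
  let t₀ : stdSimplex ℝ (Fin (0 + 1)) := default
  -- The standard `0`-simplex is one point, so a vertex is a constant map into the fibre through its
  -- image.
  refine ⟨(g t₀).1.proj, .const _ (g t₀).1.2, fun _ => (g t₀).2, ?_⟩
  refine (TopCat.toSSetObjEquiv T.Disc (.op ⦋0⦌)).injective ?_
  refine (Equiv.apply_symm_apply _ _).trans (ContinuousMap.ext fun t => ?_)
  have e : t = t₀ := Subsingleton.elim (α := stdSimplex ℝ (Fin (0 + 1))) _ _
  rw [e]
  rfl

variable {C : Type u} [Category.{v} C] [HasCoproducts.{w} C] [Abelian C] {R : C}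

/-- Every vertex is a fibre simplex, and the empty basis is positively oriented, so the
normalization selects the value `1` and never `-1`. -/
lemma ThomCocycle.ofSimplex_hom {T : TubularNeighborhood E E' f 0}
    (τ : T.ThomCocycle (fun _ => positiveOrientation) R) (s : TopCat.toSSet.obj T.Disc _⦋0⦌) :
    ofSimplex R s ≫ (chainsToRel R T.discPair).f 0 ≫ τ.hom = 𝟙 R := by
  obtain ⟨x, σ, hσ, rfl⟩ := T.exists_fiberSimplex_eq s
  have := T.subsingleton_fiber x
  rw [τ.normalized x (Module.Basis.empty _) σ hσ, if_pos (Module.Basis.orientation_isEmpty _)]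
  -- The boundary condition is vacuous: the only barycentric coordinate of a point of the
  -- `0`-simplex is `1`, never `0`.
  rintro t ⟨i, hi⟩
  have h1 : ∑ j, t j = 1 := t.2.2
  rw [Fin.sum_univ_one, ← Fin.eq_zero i] at h1
  exact absurd (hi.symm.trans h1) zero_ne_one

variable (R) in
/-- In codimension `0`, the cochain of value `1` on all vertices represents the Thom class. -/
noncomputable def thomCocycle : T.ThomCocycle (fun _ => positiveOrientation) R where
  hom := relDesc T.discPair 0 (unitCochain R T.Disc) (by
    refine chains_hom_ext fun s => ?_
    -- A vertex of the sphere bundle would be a point of an empty set, so vanishing on the subspace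
    -- is automatic.
    have p := TopCat.toSSetObjEquiv (TopCat.of T.sphere) (.op ⦋0⦌) s
      (default : stdSimplex ℝ (Fin (0 + 1)))
    have hp : p.1.1 ∈ T.sphereSet := p.2
    rw [T.sphereSet_eq_empty] at hp
    exact hp.elim)
  d_hom := by
    have := epi_chainsToRel (R := R) T.discPair (0 + 1)
    rw [← cancel_epi ((chainsToRel R T.discPair).f (0 + 1)), HomologicalComplex.Hom.comm_assoc,
      comp_zero]
    exact (whisker_eq _ (chainsToRel_relDesc T.discPair 0 _ _)).trans (d_unitCochain _)
  normalized x b σ hσ _ := by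
    rw [if_pos (Module.Basis.orientation_isEmpty b)]
    exact (whisker_eq _ (chainsToRel_relDesc T.discPair 0 _ _)).trans
      (ofSimplex_unitCochain _)

lemma isIso_excision (hf : Function.Surjective f) (n : ℕ) : IsIso (T.excision R n) := by
  have := T.isIso_tubeInclusion hf
  exact inferInstanceAs (IsIso ((relHomology R n).map T.tubeInclusion))

/-- Precomposition with the tube inclusion cancels the inverse of excision, which leaves a map
induced by a continuous map. -/
lemma tubeInclusion_umkehr (hf : Function.Surjective f)
    (τ : T.ThomCocycle (fun _ => positiveOrientation) R) (n : ℕ) :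
    (singularHomology R n).map (TopPair.Hom.fst T.tubeInclusion) ≫
        T.umkehr τ n n (add_zero n) =
      (singularHomology R n).map (TopPair.Hom.fst T.tubeToDisc ≫ T.discProj) := by
  have := T.isIso_excision (R := R) hf n
  have e : T.excision R n ≫ T.excisionInv R n = 𝟙 _ := by
    -- Excision is invertible, so the default value `0` of `excisionInv` is not taken.
    rw [excisionInv, dif_pos this, IsIso.hom_inv_id]
  exact map_homologyToRel_homologyCap T.tubeInclusion T.tubeToDisc τ.hom τ.d_hom
    τ.ofSimplex_hom n (T.excisionInv R n) e T.discProj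

/-- In codimension `0`, the umkehr map of a homeomorphism is inverse to the induced map. -/
lemma umkehr_map (φ : X ≃ₜ Y) (T : TubularNeighborhood E E' φ 0)
    (τ : T.ThomCocycle (fun _ => positiveOrientation) R) (n : ℕ) :
    T.umkehr τ n n (add_zero n) ≫
      (singularHomology R n).map (TopCat.ofHom (φ : C(X, Y))) = 𝟙 _ := by
  have : IsIso (TopPair.Hom.fst T.tubeInclusion) :=
    (T.tubeIso φ.surjective).isIso_hom
  have e : (TopPair.Hom.fst T.tubeToDisc ≫ T.discProj) ≫ TopCat.ofHom (φ : C(X, Y)) =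
      TopPair.Hom.fst T.tubeInclusion := by
    ext y
    exact T.tubeToDisc_discProj y
  -- Every class of `Y` comes from the tube, so the equality is checked there, where both sides
  -- become the map induced by the inclusion.
  refine (cancel_epi ((singularHomology R n).map (TopPair.Hom.fst T.tubeInclusion))).1 ?_
  exact (Category.assoc _ _ _).symm.trans
    ((eq_whisker (T.tubeInclusion_umkehr φ.surjective τ n) _).trans
      ((Functor.map_comp _ _ _).symm.trans
        ((congrArg (singularHomology R n).map e).trans (Category.comp_id _).symm)))

/-- A one-sided inverse of an isomorphism is two-sided. -/
lemma map_umkehr (φ : X ≃ₜ Y) (T : TubularNeighborhood E E' φ 0)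
    (τ : T.ThomCocycle (fun _ => positiveOrientation) R) (n : ℕ) :
    (singularHomology R n).map (TopCat.ofHom (φ : C(X, Y))) ≫
      T.umkehr τ n n (add_zero n) = 𝟙 _ := by
  have : IsIso (TopCat.ofHom (φ : C(X, Y))) :=
    inferInstanceAs (IsIso (TopCat.isoOfHomeo (X := TopCat.of X) (Y := TopCat.of Y) φ).hom)
  rw [← cancel_mono ((singularHomology R n).map (TopCat.ofHom (φ : C(X, Y)))), Category.assoc,
    umkehr_map φ T τ n]
  simp

end CodimZero

/-! ### Existence of a tubular neighbourhood -/

section Existence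

variable [IsManifold 𝓘(ℝ, E) ∞ X]

/-- The total space of a trivial bundle with trivial fibre is diffeomorphic to the base. -/
def trivialTotalSpaceDiffeomorph (X : Type w) [TopologicalSpace X] [ChartedSpace E X]
    (F : Type w) [NormedAddCommGroup F] [NormedSpace ℝ F] [Subsingleton F] :
    TotalSpace F (Bundle.Trivial X F) ≃ₘ^∞⟮𝓘(ℝ, E).prod 𝓘(ℝ, F), 𝓘(ℝ, E)⟯ X where
  toFun := TotalSpace.proj
  invFun := zeroSection F (Bundle.Trivial X F)
  left_inv := fun ⟨x, v⟩ => congrArg (TotalSpace.mk x) (Subsingleton.elim (α := F) 0 v)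
  right_inv _ := rfl
  contMDiff_toFun := contMDiff_proj _
  contMDiff_invFun := contMDiff_zeroSection ℝ _

/-- The tubular neighbourhood of a diffeomorphism whose normal bundle is the trivial bundle of
rank `0`. -/
noncomputable def ofDiffeomorph (h : X ≃ₘ^∞⟮𝓘(ℝ, E), 𝓘(ℝ, E')⟯ Y) :
    TubularNeighborhood E E' h 0 where
  isClosed_range := by
    rw [(EquivLike.surjective h).range_eq]
    exact isClosed_univ
  -- The index type `PEmpty.{w + 1}` puts this zero space in the universe of `X` and `Y`, as the
  -- model fibre requires.
  F := EuclideanSpace ℝ PEmpty.{w + 1}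
  V := Bundle.Trivial X (EuclideanSpace ℝ PEmpty.{w + 1})
  finrank_eq := by simp
  normedAddCommGroupV _ := inferInstanceAs (NormedAddCommGroup (EuclideanSpace ℝ PEmpty.{w + 1}))
  innerProductSpaceV _ :=
    inferInstanceAs (InnerProductSpace ℝ (EuclideanSpace ℝ PEmpty.{w + 1}))
  exp := (trivialTotalSpaceDiffeomorph (E := E) X (EuclideanSpace ℝ PEmpty.{w + 1})).trans h
  isLocalDiffeomorph_exp := Diffeomorph.isLocalDiffeomorph _
  injective_exp := EquivLike.injective _
  exp_zero _ := rfl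

end Existence
end TubularNeighborhood
end Umkehr

theorem proposition1 {K : Type v} [Ring K]
    {E : Type*} [NormedAddCommGroup E] [InnerProductSpace ℝ E] [CompleteSpace E]
    {E' : Type*} [NormedAddCommGroup E'] [InnerProductSpace ℝ E'] [CompleteSpace E']
    {X Y : Type u}
    [TopologicalSpace X] [ChartedSpace E X] [IsManifold 𝓘(ℝ, E) ∞ X] [ConnectedSpace X]
    [TopologicalSpace Y] [ChartedSpace E' Y] [IsManifold 𝓘(ℝ, E') ∞ Y] [ConnectedSpace Y]
    (h : X ≃ₘ^∞⟮𝓘(ℝ, E), 𝓘(ℝ, E')⟯ Y) :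
    (∃ T : Umkehr.TubularNeighborhood E E' h 0,
      Nonempty (T.ThomCocycle (fun _ => positiveOrientation) (Umkehr.coeff.{u} K))) ∧
    ∀ (T : Umkehr.TubularNeighborhood E E' h 0)
      (τ : T.ThomCocycle (fun _ => positiveOrientation) (Umkehr.coeff.{u} K)) (n : ℕ),
      IsIso (T.excision (Umkehr.coeff.{u} K) n) ∧
      (Umkehr.singularHomology (Umkehr.coeff.{u} K) n).map
          (TopCat.ofHom (h.toHomeomorph : C(X, Y))) ≫ T.umkehr τ n n (add_zero n) = 𝟙 _ ∧
      T.umkehr τ n n (add_zero n) ≫ (Umkehr.singularHomology (Umkehr.coeff.{u} K) n).map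
          (TopCat.ofHom (h.toHomeomorph : C(X, Y))) = 𝟙 _ :=
  ⟨⟨.ofDiffeomorph h, ⟨Umkehr.TubularNeighborhood.thomCocycle _ _⟩⟩, fun T τ n =>
    ⟨T.isIso_excision (EquivLike.surjective h) n,
      Umkehr.TubularNeighborhood.map_umkehr h.toHomeomorph T τ n,
      Umkehr.TubularNeighborhood.umkehr_map h.toHomeomorph T τ n⟩⟩
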